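/- Let $(\mathcal A,\varphi)$ be a $C^*$-algebraic probability space: $\mathcal A$ is a unital $C^*$-algebra and $\varphi:\mathcal A\to\mathbb C$ is a linear functional with $\varphi(a^*a)\ge 0$ for all $a\in\mathcal A$ and $\varphi(1)=1$. Let $X^{(1)},X^{(2)},\dots\in\mathcal A$ be self-adjoint elements such that (i) they are identically distributed: $\varphi((X^{(i)})^n)=\varphi((X^{(j)})^n)$ for all $i,j\ge1$, $n\ge0$; (ii) they are monotone independent: with $\mathcal A_i$ the (not necessarily unital) $*$-algebra generated by $X^{(i)}$, one has $$\varphi(a_1\cdots a_n)=\varphi(a_k)\,\varphi(a_1\cdots a_{k-1}a_{k+1}\cdots a_n)$$ whenever $a_j\in\mathcal A_{\lambda_j}$, $a_j\notin\mathbb C1$ for $1\le j\le n$, $\lambda_j\ne\lambda_{j+1}$ for $1\le j\le n-1$, and $\lambda_{k-1}<\lambda_k>\lambda_{k+1}$ (the first inequality is dropped if $k=1$, the second if $k=n$); (iii) $\varphi(X^{(1)})=0$ and $\varphi((X^{(1)})^2)=1$. Put $X_N:=\frac{X^{(1)}+\cdots+X^{(N)}}{\sqrt N}$. The distribution of $X_N$,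 that is, the compactly supported probability measure $\mu_N$ on $\mathbb R$ with $\int x^n\,d\mu_N(x)=\varphi(X_N^n)$ for all $n\ge0$, exists and is unique, and as $N\to\infty$ the measures $\mu_N$ converge weakly to the arcsine law with mean $0$ and variance $1$, the probability measure $\frac{1}{\pi\sqrt{2-x^2}}\mathbf 1_{(-\sqrt2,\sqrt2)}(x)\,dx$. All moments of this law are finite; they are $$M_{2n}=\int_{-\sqrt2}^{\sqrt2}\frac{x^{2n}}{\pi\sqrt{2-x^2}}\,dx=\frac{(2n-1)!!}{n!},\qquad M_{2n+1}=0\qquad(n\ge0),$$ where $(2n-1)!!=1\cdot3\cdots(2n-1)$ and $(-1)!!=1$. -/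

import Mathlib

open MeasureTheory Filter Topology
open scoped ComplexOrder

namespace MonotoneCLT

/-- A state on a unital star-algebra: a linear functional with `φ (a* a) ≥ 0` (in particular real)
and `φ 1 = 1`. -/
structure IsState {A : Type*} [Ring A] [StarRing A] [Algebra ℂ A] (φ : A →ₗ[ℂ] ℂ) : Prop where
  nonneg : ∀ a : A, 0 ≤ φ (star a * a)
  map_one : φ 1 = 1

/-- Monotone independence of a family of (not necessarily unital) star-subalgebras indexed by a
linear order. A word `a₁ ⋯ aₙ` with `aₖ ∈ 𝒜 (lₖ)` is a list of pairs `(lₖ, aₖ)`; its letters are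
not scalar multiples of `1` and consecutive indices differ. Such a word is split as
`u ++ p :: v`, where `p` is the letter `aᵢ` whose index is greater than that of its left neighbour
(the last letter of `u`, if any) and that of its right neighbour (the first letter of `v`, if any).
-/
def MonotoneIndependentSubalgebras {A Λ : Type*} [Ring A] [StarRing A] [Algebra ℂ A]
    [LinearOrder Λ] (φ : A →ₗ[ℂ] ℂ) (𝒜 : Λ → NonUnitalStarSubalgebra ℂ A) : Prop :=
  ∀ (u v : List (Λ × A)) (p : Λ × A),
    (∀ q ∈ u ++ p :: v, q.2 ∈ 𝒜 q.1 ∧ ∀ c : ℂ, q.2 ≠ algebraMap ℂ A c) →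
    List.IsChain (fun q r => q.1 ≠ r.1) (u ++ p :: v) →
    (∀ q ∈ u.getLast?, q.1 < p.1) →
    (∀ q ∈ v.head?, q.1 < p.1) →
    φ ((u ++ p :: v).map Prod.snd).prod = φ p.2 * φ ((u ++ v).map Prod.snd).prod

/-- Elements are monotone independent if the (non-unital) star-subalgebras that they generate
are. -/
def MonotoneIndependent {A Λ : Type*} [Ring A] [StarRing A] [Algebra ℂ A] [StarModule ℂ A]
    [LinearOrder Λ] (φ : A →ₗ[ℂ] ℂ) (x : Λ → A) : Prop :=
  MonotoneIndependentSubalgebras φ fun l => NonUnitalStarAlgebra.adjoin ℂ {x l}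

/-- Identical distribution in the sense of moments. -/
def IdenticallyDistributed {A Λ : Type*} [Ring A] [Algebra ℂ A]
    (φ : A →ₗ[ℂ] ℂ) (x : Λ → A) : Prop :=
  ∀ (i j : Λ) (n : ℕ), φ (x i ^ n) = φ (x j ^ n)

/-- `μ` is the probability distribution of the self-adjoint element `a` with respect to `φ`:
the compactly supported probability measure on `ℝ` whose moments are those of `a`. -/
def IsDistribution {A : Type*} [Ring A] [Algebra ℂ A] (φ : A →ₗ[ℂ] ℂ) (a : A)
    (μ : ProbabilityMeasure ℝ) : Prop :=
  (∃ K : Set ℝ, IsCompact K ∧ (μ : Measure ℝ) Kᶜ = 0) ∧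
    ∀ n : ℕ, φ (a ^ n) = ((∫ x, x ^ n ∂(μ : Measure ℝ) : ℝ) : ℂ)

/-- `(x₀ + ⋯ + x_{N-1}) / √N`. -/
noncomputable def normalizedSum {A : Type*} [Ring A] [Algebra ℂ A] (x : ℕ → A) (N : ℕ) : A :=
  ((√(N : ℝ) : ℝ) : ℂ)⁻¹ • ∑ i ∈ Finset.range N, x i

/-- The measure with density `1 / (π √(2 - x²))` on `(-√2, √2)`. -/
noncomputable def arcsineMeasure : Measure ℝ :=
  (volume.restrict (Set.Ioo (-√2) √2)).withDensity
    fun x => ENNReal.ofReal (1 / (Real.pi * √(2 - x ^ 2)))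

theorem isProbabilityMeasure_arcsineMeasure : IsProbabilityMeasure arcsineMeasure := by
  have h2 : (0 : ℝ) < √2 := by positivity
  have hsq : √2 ^ 2 = (2 : ℝ) := Real.sq_sqrt (by norm_num)
  have hle : -√2 ≤ √2 := by linarith
  have hcont : ContinuousOn (fun x : ℝ => Real.arcsin (x / √2) / Real.pi)
      (Set.Icc (-√2) √2) := by
    have := Real.continuous_arcsin
    fun_prop
  have hderiv : ∀ x ∈ Set.Ioo (-√2) √2, HasDerivAt (fun x : ℝ => Real.arcsin (x / √2) / Real.pi)
      (1 / (Real.pi * √(2 - x ^ 2))) x := by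
    intro x hx
    have h1 : x / √2 ≠ -1 := by
      intro h
      rw [div_eq_iff h2.ne'] at h
      linarith [hx.1]
    have h3 : x / √2 ≠ 1 := by
      intro h
      rw [div_eq_iff h2.ne'] at h
      linarith [hx.2]
    have h := ((Real.hasDerivAt_arcsin h1 h3).comp x
      ((hasDerivAt_id x).div_const √2)).div_const Real.pi
    refine h.congr_deriv ?_
    have hs : √(2 - x ^ 2) = √2 * √(1 - (x / √2) ^ 2) := by
      rw [← Real.sqrt_mul (by norm_num), div_pow, hsq]
      congr 1
      ring
    rw [hs, one_div_mul_one_div, div_div]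
    congr 1
    ring
  have hpos : ∀ x ∈ Set.Ioo (-√2) √2, 0 ≤ 1 / (Real.pi * √(2 - x ^ 2)) := fun x _ => by positivity
  have hint := intervalIntegral.integrableOn_deriv_of_nonneg hcont hderiv hpos
  have hval := intervalIntegral.integral_eq_sub_of_hasDerivAt_of_le hle hcont hderiv
    ((intervalIntegrable_iff_integrableOn_Ioc_of_le hle).2 hint)
  constructor
  rw [arcsineMeasure, withDensity_apply _ MeasurableSet.univ, Measure.restrict_univ,
    ← ofReal_integral_eq_lintegral_ofReal (hint.mono_set Set.Ioo_subset_Ioc_self)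
      (ae_of_all _ fun x => by positivity),
    ← integral_Ioc_eq_integral_Ioo, ← intervalIntegral.integral_of_le hle, hval,
    neg_div, div_self h2.ne', Real.arcsin_neg, Real.arcsin_one]
  have := Real.pi_ne_zero
  field_simp
  norm_num

/-- The arcsine law with mean `0` and variance `1`, on `[-√2, √2]`. -/
noncomputable def arcsineLaw : ProbabilityMeasure ℝ :=
  ⟨arcsineMeasure, isProbabilityMeasure_arcsineMeasure⟩

end MonotoneCLT

/-! The proof is by the method of moments. Write S_N for the sum of `X 0`, …, `X (N - 1)`, and
expand S_{N+1}^n = (S_N + `X N`)^n into words. The index `N` exceeds every index occurring in S_N,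
so monotone independence lets each maximal run of `X N` be replaced by its moment. This gives
φ(S_{N+1}^n) = φ(P_n(S_N)), where P_n (`condExpPoly`) depends only on the common moments and not on
`N`.

With mean 0 and variance 1, P_n = x^n + (n-1) x^(n-2) + terms of degree < n-2: a word with one
letter `X N` contributes 0, a word with two contributes 1 exactly when they are adjacent, which
happens for n-1 words, and all other words have lower degree (`condExpPoly_sub_mem_degreeLT`). The
resulting recurrence in `N` is Pascal's rule up to lower order, so φ(S_N^(2k)) is (2k-1)!! · C(N, k)
with an error O(N^(k-1/2)), and odd moments are of lower order (`exists_norm_sub_leadingMoment_le`).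
Dividing by N^k leaves (2k-1)!!/k!, the arcsine moment.

Distributions exist by functional calculus and the Riesz–Markov–Kakutani theorem
(`exists_isDistribution`). Weierstrass approximation turns convergence of moments into weak
convergence (`tendsto_of_tendsto_moments`), which also yields uniqueness. -/

namespace MonotoneCLT

/-! ### Moments of the arcsine law. -/

/-- Change of variables `x = √2 sin θ` for the arcsine law. -/
theorem integral_arcsineMeasure (g : ℝ → ℝ) :
    ∫ x, g x ∂arcsineMeasure =
      Real.pi⁻¹ * ∫ θ in (-(Real.pi / 2))..(Real.pi / 2), g (√2 * Real.sin θ) := by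
  have h2 : (0 : ℝ) < √2 := by positivity
  have hsq : √2 ^ 2 = (2 : ℝ) := Real.sq_sqrt (by norm_num)
  have himage : (fun θ => √2 * Real.sin θ) '' Set.Ioo (-(Real.pi / 2)) (Real.pi / 2) =
      Set.Ioo (-√2) √2 := by
    ext x
    constructor
    · rintro ⟨θ, hθ, rfl⟩
      have := Real.mapsTo_sin_Ioo hθ
      constructor <;> simp only <;> nlinarith [this.1, this.2]
    · intro hx
      refine ⟨Real.arcsin (x / √2), ⟨?_, ?_⟩, ?_⟩
      · rw [Real.neg_pi_div_two_lt_arcsin, lt_div_iff₀ h2]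
        linarith [hx.1]
      · rw [Real.arcsin_lt_pi_div_two, div_lt_iff₀ h2]
        linarith [hx.2]
      · simp only
        rw [Real.sin_arcsin]
        · field_simp
        · rw [le_div_iff₀ h2]
          linarith [hx.1]
        · rw [div_le_iff₀ h2]
          linarith [hx.2]
  have hmeas : Measurable fun x : ℝ => ENNReal.ofReal (1 / (Real.pi * √(2 - x ^ 2))) := by
    fun_prop
  rw [arcsineMeasure, integral_withDensity_eq_integral_toReal_smul hmeas
    (ae_of_all _ fun x => ENNReal.ofReal_lt_top), ← himage,
    integral_image_eq_integral_abs_deriv_smul measurableSet_Ioo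
      (f' := fun θ => √2 * Real.cos θ)
      (fun θ _ => ((Real.hasDerivAt_sin θ).const_mul √2).hasDerivWithinAt),
    ← intervalIntegral.integral_const_mul, intervalIntegral.integral_of_le
      (by linarith [Real.pi_pos]), integral_Ioc_eq_integral_Ioo]
  · refine setIntegral_congr_fun measurableSet_Ioo fun θ hθ => ?_
    have hc := Real.cos_pos_of_mem_Ioo hθ
    have hs : √(2 - (√2 * Real.sin θ) ^ 2) = √2 * Real.cos θ := by
      rw [mul_pow, hsq, Real.sqrt_eq_iff_mul_self_eq_of_pos (by positivity)]
      nlinarith [Real.sin_sq_add_cos_sq θ]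
    have hpi := Real.pi_pos
    simp only [smul_eq_mul]
    rw [hs, ENNReal.toReal_ofReal (by positivity), abs_of_pos (by positivity)]
    field_simp
  · intro a ha b hb hab
    exact Real.injOn_sin ⟨ha.1.le, ha.2.le⟩ ⟨hb.1.le, hb.2.le⟩ (mul_left_cancel₀ h2.ne' hab)

theorem doubleFactorial_succ_two_mul_sub_one (n : ℕ) :
    Nat.doubleFactorial (2 * (n + 1) - 1) = (2 * n + 1) * Nat.doubleFactorial (2 * n - 1) := by
  rcases n with _ | n
  · rfl
  · rw [show 2 * (n + 1 + 1) - 1 = 2 * n + 1 + 2 by omega, Nat.doubleFactorial_add_two]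
    congr 1

theorem two_pow_mul_prod_eq_doubleFactorial_div (n : ℕ) :
    2 ^ n * ∏ i ∈ Finset.range n, (2 * (i : ℝ) + 1) / (2 * i + 2) =
      (Nat.doubleFactorial (2 * n - 1) : ℝ) / (Nat.factorial n : ℝ) := by
  induction n with
  | zero => simp
  | succ n ih =>
    rw [Finset.prod_range_succ, pow_succ, doubleFactorial_succ_two_mul_sub_one, Nat.factorial_succ,
      mul_mul_mul_comm, ih]
    push_cast
    have := Nat.factorial_pos n
    field_simp

theorem integral_pow_even_arcsineMeasure (n : ℕ) :
    ∫ x, x ^ (2 * n) ∂arcsineMeasure =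
      (Nat.doubleFactorial (2 * n - 1) : ℝ) / (Nat.factorial n : ℝ) := by
  -- Even powers of sine have period π, so the integral over [-π/2, π/2] equals the Wallis integral
  -- over [0, π].
  have hper : Function.Periodic (fun θ => Real.sin θ ^ (2 * n)) Real.pi := fun θ => by
    simp [Real.sin_add_pi, (even_two_mul n).neg_pow]
  have h := hper.intervalIntegral_add_eq (-(Real.pi / 2)) 0
  rw [zero_add, show -(Real.pi / 2) + Real.pi = Real.pi / 2 by ring, integral_sin_pow_even] at h
  rw [integral_arcsineMeasure]
  simp_rw [mul_pow]
  rw [intervalIntegral.integral_const_mul, h, ← two_pow_mul_prod_eq_doubleFactorial_div, pow_mul,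
    Real.sq_sqrt (by norm_num)]
  have := Real.pi_pos
  field_simp

theorem integral_pow_odd_arcsineMeasure (n : ℕ) :
    ∫ x, x ^ (2 * n + 1) ∂arcsineMeasure = 0 := by
  rw [integral_arcsineMeasure]
  have h := intervalIntegral.integral_comp_neg (a := -(Real.pi / 2)) (b := Real.pi / 2)
    fun θ => (√2 * Real.sin θ) ^ (2 * n + 1)
  simp only [Real.sin_neg, mul_neg, neg_neg, (odd_two_mul_add_one n).neg_pow,
    intervalIntegral.integral_neg] at h
  rw [show (∫ θ in (-(Real.pi / 2))..(Real.pi / 2), (√2 * Real.sin θ) ^ (2 * n + 1)) = 0 by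
    linarith, mul_zero]

theorem arcsineMeasure_compl_Icc : arcsineMeasure (Set.Icc (-√2) √2)ᶜ = 0 := by
  refine withDensity_absolutelyContinuous _ _ ?_
  rw [Measure.restrict_apply measurableSet_Icc.compl,
    (Set.disjoint_compl_left_iff_subset.2 Set.Ioo_subset_Icc_self).inter_eq, measure_empty]

/-! ### The method of moments for compactly supported limits. -/

theorem integrable_pow_of_compl_null {μ : Measure ℝ} [IsFiniteMeasure μ] {K : Set ℝ}
    (hK : IsCompact K) (hμ : μ Kᶜ = 0) (n : ℕ) : Integrable (fun x : ℝ => x ^ n) μ := by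
  have h : μ.restrict K = μ := Measure.restrict_eq_self_of_ae_mem hμ
  rw [← h]
  exact (continuous_pow n).continuousOn.integrableOn_compact hK

theorem integral_polynomial_eval {μ : Measure ℝ} (hμ : ∀ n : ℕ, Integrable (fun x : ℝ => x ^ n) μ)
    (p : Polynomial ℝ) :
    Integrable (fun x => p.eval x) μ ∧
      ∫ x, p.eval x ∂μ = ∑ i ∈ p.support, p.coeff i * ∫ x, x ^ i ∂μ := by
  simp_rw [Polynomial.eval_eq_sum, Polynomial.sum]
  refine ⟨integrable_finsetSum _ fun i _ => (hμ i).const_mul _, ?_⟩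
  rw [integral_finsetSum _ fun i _ => (hμ i).const_mul _]
  simp_rw [integral_const_mul]

/-- A polynomial approximates a bounded continuous function up to `ε`, plus a remainder which is
small in `L¹` for measures whose high moments grow slower than those of the point mass at `R`. -/
theorem exists_polynomial_abs_sub_le (f : BoundedContinuousFunction ℝ ℝ) {R ε : ℝ} (hR : 1 ≤ R)
    (hε : 0 < ε) : ∃ (p : Polynomial ℝ) (C : ℝ) (k : ℕ), 0 ≤ C ∧
      ∀ (m : ℕ) (x : ℝ), |p.eval x - f x| ≤ ε + C / R ^ (2 * m) * x ^ (2 * (k + m)) := by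
  -- Weierstrass handles [-R, R]. Outside, |p - f| is at most C|x|^(2k), and the factor (|x|/R)^(2m)
  -- ≥ 1 comes for free. Even exponents keep the remainder a nonnegative monomial, whose integral is
  -- a single moment.
  obtain ⟨p, hp⟩ := exists_polynomial_near_of_continuousOn (-R) R f f.continuous.continuousOn ε hε
  set k := p.natDegree
  set C := ‖f‖ + ∑ i ∈ p.support, |p.coeff i|
  have hC : 0 ≤ C := by positivity
  refine ⟨p, C, k, hC, fun m x => ?_⟩
  have hR0 : 0 < R := by linarith
  have hrem : 0 ≤ C / R ^ (2 * m) * x ^ (2 * (k + m)) :=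
    mul_nonneg (by positivity) ((even_two_mul _).pow_nonneg x)
  by_cases hx : x ∈ Set.Icc (-R) R
  · linarith [hp x hx]
  have hx : R < |x| := by
    by_contra! h
    exact hx (abs_le.1 h)
  have hx1 : 1 ≤ |x| := by linarith
  have hpow : x ^ (2 * (k + m)) = |x| ^ (2 * k) * |x| ^ (2 * m) := by
    rw [← pow_add, ← mul_add, (even_two_mul (k + m)).pow_abs]
  have hf : |f x| ≤ ‖f‖ * |x| ^ (2 * k) :=
    (f.norm_coe_le_norm x).trans (le_mul_of_one_le_right (norm_nonneg f) (one_le_pow₀ hx1))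
  have hpx : |p.eval x| ≤ (∑ i ∈ p.support, |p.coeff i|) * |x| ^ (2 * k) := by
    rw [Polynomial.eval_eq_sum, Polynomial.sum, Finset.sum_mul]
    refine (Finset.abs_sum_le_sum_abs _ _).trans (Finset.sum_le_sum fun i hi => ?_)
    rw [abs_mul, abs_pow]
    have : i ≤ p.natDegree := Polynomial.le_natDegree_of_mem_supp i hi
    gcongr ?_ * ?_
    exact pow_le_pow_right₀ hx1 (by omega)
  have hmain : |p.eval x - f x| ≤ C * |x| ^ (2 * k) := by
    refine (abs_sub _ _).trans ?_
    rw [add_mul]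
    linarith
  have hratio : 1 ≤ |x| ^ (2 * m) / R ^ (2 * m) := by
    rw [one_le_div (by positivity)]
    gcongr
  calc |p.eval x - f x| ≤ C * |x| ^ (2 * k) := hmain
    _ ≤ C * |x| ^ (2 * k) * (|x| ^ (2 * m) / R ^ (2 * m)) :=
        le_mul_of_one_le_right (by positivity) hratio
    _ = C / R ^ (2 * m) * x ^ (2 * (k + m)) := by rw [hpow]; ring
    _ ≤ _ := by linarith

theorem abs_integral_sub_integral_polynomial_le {μ : ProbabilityMeasure ℝ}
    (hμ : ∀ n : ℕ, Integrable (fun x : ℝ => x ^ n) (μ : Measure ℝ))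
    (f : BoundedContinuousFunction ℝ ℝ) (p : Polynomial ℝ) {ε D : ℝ} {n : ℕ}
    (h : ∀ x, |p.eval x - f x| ≤ ε + D * x ^ n) :
    |∫ x, p.eval x ∂(μ : Measure ℝ) - ∫ x, f x ∂(μ : Measure ℝ)| ≤
      ε + D * ∫ x, x ^ n ∂(μ : Measure ℝ) := by
  have hp := (integral_polynomial_eval hμ p).1
  have hf := f.integrable (μ : Measure ℝ)
  rw [← integral_sub hp hf]
  refine abs_integral_le_integral_abs.trans ?_
  refine (integral_mono (hp.sub hf).abs
    ((integrable_const ε).add ((hμ n).const_mul D)) h).trans_eq ?_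
  simp only [Pi.add_apply]
  rw [integral_add (integrable_const ε) ((hμ n).const_mul D), integral_const_mul]
  simp

theorem integral_pow_le_of_compl_Icc_null {μ : ProbabilityMeasure ℝ} {r : ℝ}
    (hr : (μ : Measure ℝ) (Set.Icc (-r) r)ᶜ = 0) (n : ℕ) :
    ∫ x, x ^ n ∂(μ : Measure ℝ) ≤ r ^ n := by
  have h_int := integrable_pow_of_compl_null isCompact_Icc hr n
  have hae : ∀ᵐ x ∂(μ : Measure ℝ), x ∈ Set.Icc (-r) r := by rwa [← mem_ae_iff] at hr
  refine (integral_mono_ae h_int (integrable_const (r ^ n)) ?_).trans_eq (by simp)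
  filter_upwards [hae] with x hx
  calc x ^ n ≤ |x ^ n| := le_abs_self _
    _ = |x| ^ n := abs_pow x n
    _ ≤ r ^ n := by
      gcongr
      exact abs_le.2 hx

/-- Method of moments: convergence of all moments to those of a compactly supported law implies
weak convergence. -/
theorem tendsto_of_tendsto_moments {μ : ℕ → ProbabilityMeasure ℝ} {ν : ProbabilityMeasure ℝ}
    (hμ : ∀ N n : ℕ, Integrable (fun x : ℝ => x ^ n) (μ N : Measure ℝ))
    {K : Set ℝ} (hK : IsCompact K) (hν : (ν : Measure ℝ) Kᶜ = 0)
    (h : ∀ n : ℕ, Tendsto (fun N => ∫ x, x ^ n ∂(μ N : Measure ℝ)) atTop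
      (𝓝 (∫ x, x ^ n ∂(ν : Measure ℝ)))) :
    Tendsto μ atTop (𝓝 ν) := by
  obtain ⟨r, hr0, hr⟩ := hK.isBounded.subset_closedBall_lt 0 0
  rw [Real.closedBall_eq_Icc, zero_sub, zero_add] at hr
  have hνr : (ν : Measure ℝ) (Set.Icc (-r) r)ᶜ = 0 :=
    measure_mono_null (Set.compl_subset_compl.2 hr) hν
  have hνi := integrable_pow_of_compl_null hK hν
  rw [ProbabilityMeasure.tendsto_iff_forall_integral_tendsto]
  intro f
  rw [Metric.tendsto_atTop']
  intro ε hε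
  -- Taking R = r + 1 strictly beyond the support makes the remainder under `ν` at most C r^(2k)
  -- (r/(r+1))^(2m), which is small for large m. Convergence of the one moment of order 2(k + m)
  -- then transfers this to `μ N`, replacing a tightness argument. Five errors of size ε/8 add up to
  -- less than ε.
  obtain ⟨p, C, k, hC, hp⟩ := exists_polynomial_abs_sub_le f
    (R := r + 1) (ε := ε / 8) (by linarith) (by positivity)
  have hgeom : Tendsto (fun m : ℕ => C * r ^ (2 * k) * ((r / (r + 1)) ^ 2) ^ m) atTop (𝓝 0) := by
    rw [← mul_zero (C * r ^ (2 * k))]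
    refine (tendsto_pow_atTop_nhds_zero_of_lt_one (by positivity) ?_).const_mul _
    have : r / (r + 1) < 1 := by rw [div_lt_one (by linarith)]; linarith
    exact pow_lt_one₀ (by positivity) this two_ne_zero
  obtain ⟨m, hm⟩ := (hgeom.eventually_lt_const (show (0 : ℝ) < ε / 8 by positivity)).exists
  set D := C / (r + 1) ^ (2 * m)
  have hD : 0 ≤ D := by positivity
  have hDν : D * ∫ x, x ^ (2 * (k + m)) ∂(ν : Measure ℝ) < ε / 8 := by
    refine lt_of_le_of_lt (mul_le_mul_of_nonneg_left
      (integral_pow_le_of_compl_Icc_null hνr _) hD) ?_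
    convert hm using 1
    simp only [D]
    rw [← pow_mul, div_pow]
    ring
  have hDμ := ((h (2 * (k + m))).const_mul D).eventually_lt_const hDν
  have hpoly : Tendsto (fun N => ∫ x, p.eval x ∂(μ N : Measure ℝ)) atTop
      (𝓝 (∫ x, p.eval x ∂(ν : Measure ℝ))) := by
    rw [(integral_polynomial_eval hνi p).2]
    simp_rw [fun N => (integral_polynomial_eval (hμ N) p).2]
    exact tendsto_finsetSum _ fun i _ => (h i).const_mul _
  have hpoly' := hpoly.eventually (Metric.ball_mem_nhds _ (show (0 : ℝ) < ε / 8 by positivity))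
  obtain ⟨N₀, hN₀⟩ := eventually_atTop.1 (hDμ.and hpoly')
  refine ⟨N₀, fun N hN => ?_⟩
  obtain ⟨h₁, h₂⟩ := hN₀ N hN.le
  have e₁ := abs_integral_sub_integral_polynomial_le (hμ N) f p (hp m)
  have e₂ := abs_integral_sub_integral_polynomial_le hνi f p (hp m)
  rw [Real.dist_eq] at h₂
  rw [Real.dist_eq]
  rw [abs_lt] at h₂ ⊢
  rw [abs_le] at e₁ e₂
  constructor <;> linarith [e₁.1, e₁.2, e₂.1, e₂.2, h₂.1, h₂.2]

/-- The constant sequence `μ` converges to `ν` by the method of moments, and weak limits are unique.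
-/
theorem eq_of_moments_eq {μ ν : ProbabilityMeasure ℝ} {K L : Set ℝ}
    (hK : IsCompact K) (hμ : (μ : Measure ℝ) Kᶜ = 0)
    (hL : IsCompact L) (hν : (ν : Measure ℝ) Lᶜ = 0)
    (h : ∀ n : ℕ, ∫ x, x ^ n ∂(μ : Measure ℝ) = ∫ x, x ^ n ∂(ν : Measure ℝ)) : μ = ν := by
  refine tendsto_nhds_unique (tendsto_const_nhds (f := (atTop : Filter ℕ))) ?_
  refine tendsto_of_tendsto_moments (fun _ => integrable_pow_of_compl_null hK hμ) hL hν
    fun n => ?_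
  rw [h n]
  exact tendsto_const_nhds

/-! ### Existence and uniqueness of the distribution of a self-adjoint element. -/

open scoped CompactlySupported in
/-- Every self-adjoint element has a probability distribution with respect to a state. -/
theorem exists_isDistribution {A : Type*} [CStarAlgebra A] {φ : A →ₗ[ℂ] ℂ} (hφ : IsState φ)
    {a : A} (ha : IsSelfAdjoint a) : ∃ μ : ProbabilityMeasure ℝ, IsDistribution φ a μ := by
  -- Composing `φ` with the continuous functional calculus gives a positive functional on
  -- C(spectrum), since f = (√f)² for f ≥ 0. Its Riesz measure, pushed forward to ℝ, is the
  -- distribution.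
  let Φ := cfcHom (R := ℝ) (p := IsSelfAdjoint) ha
  have hpos : ∀ f : C(spectrum ℝ a, ℝ), 0 ≤ f → 0 ≤ φ (Φ f) := by
    intro f hf
    let g : C(spectrum ℝ a, ℝ) := ⟨fun x => √(f x), by fun_prop⟩
    have hg : f = star g * g := by
      ext x
      exact (Real.mul_self_sqrt (hf x)).symm
    rw [hg, map_mul, map_star]
    exact hφ.nonneg _
  have him : ∀ f : C(spectrum ℝ a, ℝ), (φ (Φ f)).im = 0 := by
    intro f
    -- f is the difference of the nonnegative functions f⁺ and f⁺ - f, on which the functional takes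
    -- real values.
    have h₁ := (Complex.nonneg_iff.1 (hpos (f ⊔ 0) le_sup_right)).2
    have h₂ := (Complex.nonneg_iff.1 (hpos (f ⊔ 0 - f) (sub_nonneg.2 le_sup_left))).2
    rw [map_sub, map_sub, Complex.sub_im] at h₂
    linarith
  let Λ : C_c(spectrum ℝ a, ℝ) →ₚ[ℝ] ℝ := PositiveLinearMap.mk₀
    { toFun := fun f => (φ (Φ f)).re
      map_add' := fun f g => by
        have : ((f + g : C_c(spectrum ℝ a, ℝ)) : C(spectrum ℝ a, ℝ)) = f + g := rfl
        rw [this, map_add, map_add, Complex.add_re]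
      map_smul' := fun c f => by
        have : ((c • f : C_c(spectrum ℝ a, ℝ)) : C(spectrum ℝ a, ℝ)) =
          c • (f : C(spectrum ℝ a, ℝ)) := rfl
        rw [this, map_smul, ← Complex.coe_smul, map_smul]
        simp }
    fun f hf => (Complex.nonneg_iff.1 (hpos f hf)).1
  have h_int : ∀ f : C(spectrum ℝ a, ℝ), ((∫ x, f x ∂(RealRMK.rieszMeasure Λ) : ℝ) : ℂ) =
      φ (Φ f) := by
    intro f
    have h := RealRMK.integral_rieszMeasure Λ
      (CompactlySupportedContinuousMap.continuousMapEquiv f)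
    have h' : ∫ x, f x ∂(RealRMK.rieszMeasure Λ) = (φ (Φ f)).re := h
    rw [h']
    exact Complex.ext (by simp) (by simp [him f])
  set ρ := RealRMK.rieszMeasure Λ
  have hρ : IsProbabilityMeasure ρ := by
    have h := h_int 1
    rw [map_one, hφ.map_one] at h
    have h' : ρ.real Set.univ = 1 := by
      simpa using Complex.ofReal_injective (h.trans Complex.ofReal_one.symm)
    constructor
    rwa [measureReal_def, ENNReal.toReal_eq_one_iff] at h'
  have hval : Measurable (Subtype.val : spectrum ℝ a → ℝ) := measurable_subtype_coe
  refine ⟨⟨ρ.map Subtype.val, Measure.isProbabilityMeasure_map hval.aemeasurable⟩,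
    ⟨spectrum ℝ a, ContinuousFunctionalCalculus.isCompact_spectrum a, ?_⟩, fun n => ?_⟩
  · simp only [ProbabilityMeasure.coe_mk]
    rw [Measure.map_apply hval
      (ContinuousFunctionalCalculus.isCompact_spectrum a).measurableSet.compl]
    simp
  · simp only [ProbabilityMeasure.coe_mk]
    rw [integral_map hval.aemeasurable (by fun_prop)]
    have h := h_int ((ContinuousMap.id ℝ).restrict (spectrum ℝ a) ^ n)
    rw [map_pow, cfcHom_id] at h
    exact h.symm

theorem existsUnique_isDistribution {A : Type*} [CStarAlgebra A] {φ : A →ₗ[ℂ] ℂ}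
    (hφ : IsState φ) {a : A} (ha : IsSelfAdjoint a) :
    ∃! μ : ProbabilityMeasure ℝ, IsDistribution φ a μ := by
  obtain ⟨μ, hμ⟩ := exists_isDistribution hφ ha
  refine ⟨μ, hμ, fun ν hν => ?_⟩
  obtain ⟨⟨K, hK, hμK⟩, hμm⟩ := hμ
  obtain ⟨⟨L, hL, hνL⟩, hνm⟩ := hν
  exact eq_of_moments_eq hL hνL hK hμK fun n =>
    Complex.ofReal_injective ((hνm n).symm.trans (hμm n))

/-! ### Factorisation of words under monotone independence. -/

theorem IsState.continuous {A : Type*} [CStarAlgebra A] {φ : A →ₗ[ℂ] ℂ} (hφ : IsState φ) :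
    Continuous φ := by
  let _ := CStarAlgebra.spectralOrder A
  have := CStarAlgebra.spectralOrderedRing A
  let ψ : A →ₚ[ℂ] ℂ := PositiveLinearMap.mk₀ φ fun x hx => by
    obtain ⟨b, rfl⟩ := CStarAlgebra.nonneg_iff_eq_star_mul_self.1 hx
    exact hφ.nonneg b
  exact map_continuous ψ

/-- Monotone independence of non-scalar elements extends by continuity to words some of whose
letters are scalars. -/
theorem MonotoneIndependent.map_prod_of_isChain {A : Type*} [CStarAlgebra A] {φ : A →ₗ[ℂ] ℂ}
    (hφ : Continuous φ) {X : ℕ → A} (hX : ∀ i (c : ℂ), X i ≠ algebraMap ℂ A c)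
    (hind : MonotoneIndependent φ X) (u v : List (ℕ × A)) (p : ℕ × A)
    (hmem : ∀ q ∈ u ++ p :: v, q.2 ∈ NonUnitalStarAlgebra.adjoin ℂ {X q.1})
    (hchain : List.IsChain (fun q r => q.1 ≠ r.1) (u ++ p :: v))
    (hu : ∀ q ∈ u.getLast?, q.1 < p.1) (hv : ∀ q ∈ v.head?, q.1 < p.1) :
    φ ((u ++ p :: v).map Prod.snd).prod = φ p.2 * φ ((u ++ v).map Prod.snd).prod := by
  -- Each letter a of index i is perturbed to a + ε • `X i`, which stays in the same subalgebra and
  -- keeps the pattern of indices.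
  let T : ℂ → ℕ × A → ℕ × A := fun ε q => (q.1, q.2 + ε • X q.1)
  have hT0 : T 0 = id := by
    funext q
    simp [T]
  have hne : ∀ᶠ ε in 𝓝[≠] (0 : ℂ), ∀ q ∈ {q | q ∈ u ++ p :: v}, ∀ c : ℂ,
      (T ε q).2 ≠ algebraMap ℂ A c := by
    rw [eventually_all_finite (List.finite_toSet _)]
    intro q _
    -- At most one nonzero ε can make a given letter scalar: two such values would make `X q.1`
    -- itself scalar. Hence all ε ≠ 0 close enough to 0 are admissible.
    by_cases h : ∃ ε₀ : ℂ, ε₀ ≠ 0 ∧ ∃ c₀ : ℂ, (T ε₀ q).2 = algebraMap ℂ A c₀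
    · obtain ⟨ε₀, hε₀, c₀, hc₀⟩ := h
      filter_upwards [nhdsWithin_le_nhds (isOpen_ne.mem_nhds hε₀.symm)] with ε hε c hc
      have hsub : ε - ε₀ ≠ 0 := sub_ne_zero.2 hε
      have h1 : (ε - ε₀) • X q.1 = algebraMap ℂ A (c - c₀) := by
        rw [map_sub, ← hc, ← hc₀, sub_smul]
        simp only [T]
        abel
      refine hX q.1 ((ε - ε₀)⁻¹ * (c - c₀)) ?_
      rw [map_mul, ← h1, ← Algebra.smul_def, smul_smul, inv_mul_cancel₀ hsub, one_smul]
    · push Not at h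
      filter_upwards [self_mem_nhdsWithin] with ε hε c
      exact h ε hε c
  have hcont : ∀ l : List (ℕ × A), Continuous fun ε : ℂ => φ ((l.map (T ε)).map Prod.snd).prod := by
    intro l
    simp only [List.map_map]
    refine hφ.comp (continuous_list_prod l fun q _ => ?_)
    simp only [Function.comp_apply, T]
    fun_prop
  have heq : ∀ᶠ ε in 𝓝[≠] (0 : ℂ), φ (((u ++ p :: v).map (T ε)).map Prod.snd).prod =
      φ (T ε p).2 * φ (((u ++ v).map (T ε)).map Prod.snd).prod := by
    filter_upwards [hne] with ε hε
    have h := hind (u.map (T ε)) (v.map (T ε)) (T ε p)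
    rw [← List.map_cons, ← List.map_append, ← List.map_append] at h
    refine h ?_ ?_ ?_ ?_
    · intro q' hq'
      obtain ⟨q, hq, rfl⟩ := List.mem_map.1 hq'
      exact ⟨add_mem (hmem q hq) (SMulMemClass.smul_mem ε
        (NonUnitalStarAlgebra.self_mem_adjoin_singleton ℂ (X q.1))), hε q hq⟩
    · rw [List.isChain_map]
      exact hchain
    · intro q' hq'
      rw [List.getLast?_map, Option.mem_map] at hq'
      obtain ⟨q, hq, rfl⟩ := hq'
      exact hu q hq
    · intro q' hq'
      rw [List.head?_map, Option.mem_map] at hq'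
      obtain ⟨q, hq, rfl⟩ := hq'
      exact hv q hq
  have hp : Continuous fun ε : ℂ => φ (T ε p).2 := by
    refine hφ.comp ?_
    simp only [T]
    fun_prop
  have hl := ((hcont (u ++ p :: v)).tendsto 0).mono_left (nhdsWithin_le_nhds (s := {0}ᶜ))
  have hr := ((hp.mul (hcont (u ++ v))).tendsto 0).mono_left (nhdsWithin_le_nhds (s := {0}ᶜ))
  have := tendsto_nhds_unique (hl.congr' heq) hr
  simpa only [Pi.mul_apply, hT0, List.map_id, id] using this

/-- Merging neighbouring letters of equal index turns any word into an alternating one. -/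
theorem exists_isChain_prod_eq {A Λ : Type*} [Monoid A] [DecidableEq Λ] {S : Type*} [SetLike S A]
    [MulMemClass S A] (𝒜 : Λ → S) (l : List (Λ × A)) (hl : ∀ q ∈ l, q.2 ∈ 𝒜 q.1) :
    ∃ l' : List (Λ × A), (∀ q ∈ l', q.2 ∈ 𝒜 q.1) ∧ List.IsChain (fun q r => q.1 ≠ r.1) l' ∧
      (l'.map Prod.snd).prod = (l.map Prod.snd).prod ∧
      l'.head?.map Prod.fst = l.head?.map Prod.fst ∧
      l'.getLast?.map Prod.fst = l.getLast?.map Prod.fst := by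
  induction l with
  | nil => exact ⟨[], by simp⟩
  | cons q l ih =>
    obtain ⟨l', hmem, hchain, hprod, -, hlast⟩ := ih fun r hr => hl r (List.mem_cons_of_mem _ hr)
    have hq : q.2 ∈ 𝒜 q.1 := hl q List.mem_cons_self
    have hlast' : (q :: l).getLast?.map Prod.fst = some ((l.getLast?.map Prod.fst).getD q.1) := by
      rw [List.getLast?_cons]
      cases l.getLast? <;> rfl
    rcases l' with _ | ⟨r, l'⟩
    · refine ⟨[q], by simpa using hq, by simp, by simp [← hprod], by simp, ?_⟩
      rw [hlast', ← hlast]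
      rfl
    · have hr : r.2 ∈ 𝒜 r.1 := hmem r List.mem_cons_self
      rw [List.getLast?_cons] at hlast
      by_cases hqr : q.1 = r.1
      · refine ⟨(q.1, q.2 * r.2) :: l', ?_, ?_, ?_, by simp, ?_⟩
        · intro s hs
          rcases List.mem_cons.1 hs with rfl | hs
          · exact mul_mem hq (hqr ▸ hr)
          · exact hmem s (List.mem_cons_of_mem _ hs)
        · rw [List.isChain_cons] at hchain ⊢
          exact ⟨fun y hy => by simpa [hqr] using hchain.1 y hy, hchain.2⟩
        · simp only [List.map_cons, List.prod_cons] at hprod ⊢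
          rw [← hprod, mul_assoc]
        · rw [hlast', ← hlast, List.getLast?_cons]
          cases l'.getLast? <;> simp [hqr]
      · refine ⟨q :: r :: l', ?_, ?_, ?_, by simp, ?_⟩
        · intro s hs
          rcases List.mem_cons.1 hs with rfl | hs
          · exact hq
          · exact hmem s hs
        · exact List.isChain_cons_cons.2 ⟨hqr, hchain⟩
        · rw [List.map_cons, List.prod_cons, hprod, List.map_cons, List.prod_cons]
        · rw [hlast', ← hlast, List.getLast?_cons, List.getLast?_cons]
          cases l'.getLast? <;> simp

section Words

variable {A : Type*} [CStarAlgebra A] {φ : A →ₗ[ℂ] ℂ} {X : ℕ → A}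

/-- Monotone independence only looks at the neighbours of the peak. Merging equal neighbours in `s`
and in `t` separately makes both alternating without changing the index next to the run of `X k`.
Merged letters, and `X k ^ q` itself, may be scalars, which is why the extension to scalar letters
is needed. -/
theorem MonotoneIndependent.map_word (hφ : IsState φ)
    (hX : ∀ i (c : ℂ), X i ≠ algebraMap ℂ A c) (hind : MonotoneIndependent φ X)
    (s t : List ℕ) (k q : ℕ) (hs : ∀ i ∈ s.getLast?, i < k) (ht : ∀ i ∈ t.head?, i < k) :
    φ ((s.map X).prod * (X k ^ q * (t.map X).prod)) =
      φ (X k ^ q) * φ ((s.map X).prod * (t.map X).prod) := by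
  -- For q = 0 the run is 1, which need not lie in the non-unital algebra generated by `X k`.
  rcases Nat.eq_zero_or_pos q with rfl | hq
  · simp [hφ.map_one]
  have hself : ∀ i, X i ∈ NonUnitalStarAlgebra.adjoin ℂ {X i} := fun i =>
    NonUnitalStarAlgebra.self_mem_adjoin_singleton ℂ (X i)
  have hletters : ∀ l : List ℕ, ∀ r ∈ l.map fun i => (i, X i),
      r.2 ∈ NonUnitalStarAlgebra.adjoin ℂ {X r.1} := by
    intro l r hr
    obtain ⟨i, -, rfl⟩ := List.mem_map.1 hr
    exact hself i
  obtain ⟨u, hu, huc, hup, -, hul⟩ := exists_isChain_prod_eq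
    (fun i => NonUnitalStarAlgebra.adjoin ℂ {X i}) _ (hletters s)
  obtain ⟨v, hv, hvc, hvp, hvh, -⟩ := exists_isChain_prod_eq
    (fun i => NonUnitalStarAlgebra.adjoin ℂ {X i}) _ (hletters t)
  have hfst : ∀ o : Option ℕ, (o.map fun i => (i, X i)).map Prod.fst = o := by
    intro o
    cases o <;> rfl
  rw [List.getLast?_map, hfst] at hul
  rw [List.head?_map, hfst] at hvh
  have hul' : ∀ r ∈ u.getLast?, r.1 < k := fun r hr =>
    hs _ (hul ▸ Option.mem_map_of_mem Prod.fst hr)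
  have hvh' : ∀ r ∈ v.head?, r.1 < k := fun r hr =>
    ht _ (hvh ▸ Option.mem_map_of_mem Prod.fst hr)
  have hpow : X k ^ q ∈ NonUnitalStarAlgebra.adjoin ℂ {X k} := by
    induction q, hq using Nat.le_induction with
    | base => simp
    | succ n _ ih => exact pow_succ (X k) n ▸ mul_mem ih (hself k)
  have h := hind.map_prod_of_isChain hφ.continuous hX u v (k, X k ^ q) ?_ ?_ hul' hvh'
  · simpa only [List.map_append, List.map_cons, List.prod_append, List.prod_cons, hup, hvp,
      List.map_map, Function.comp_def] using h
  · intro r hr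
    rcases List.mem_append.1 hr with hr | hr
    · exact hu r hr
    · rcases List.mem_cons.1 hr with rfl | hr
      · exact hpow
      · exact hv r hr
  · refine huc.append (List.isChain_cons.2 ⟨fun r hr => (hvh' r hr).ne', hvc⟩) ?_
    intro r hr r' hr'
    obtain rfl : (k, X k ^ q) = r' := by simpa using hr'
    exact (hul' r hr).ne

theorem mem_span_words_of_mem_adjoin {I : Set ℕ} {a : A} (ha : a ∈ Algebra.adjoin ℂ (X '' I)) :
    a ∈ Submodule.span ℂ {w | ∃ s : List ℕ, (∀ i ∈ s, i ∈ I) ∧ (s.map X).prod = w} := by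
  rw [← Subalgebra.mem_toSubmodule, Algebra.adjoin_eq_span] at ha
  refine Submodule.span_mono ?_ ha
  intro w hw
  induction hw using Submonoid.closure_induction with
  | mem x hx =>
    obtain ⟨i, hi, rfl⟩ := hx
    exact ⟨[i], by simpa using hi, by simp⟩
  | one => exact ⟨[], by simp, by simp⟩
  | mul x y _ _ hx hy =>
    obtain ⟨s, hs, rfl⟩ := hx
    obtain ⟨t, ht, rfl⟩ := hy
    refine ⟨s ++ t, fun i hi => ?_, by simp⟩
    rcases List.mem_append.1 hi with hi | hi
    · exact hs i hi
    · exact ht i hi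

/-- The letter `X k` between an element of the algebra generated by lower letters and `c` can be
taken out, when `c` is a combination of words that are empty or start with a lower letter. -/
theorem MonotoneIndependent.map_mul_pow_mul (hφ : IsState φ)
    (hX : ∀ i (c : ℂ), X i ≠ algebraMap ℂ A c) (hind : MonotoneIndependent φ X) (k q : ℕ)
    {a c : A} (ha : a ∈ Algebra.adjoin ℂ (X '' Set.Iio k))
    (hc : c ∈ Submodule.span ℂ {w | ∃ t : List ℕ, (∀ i ∈ t.head?, i < k) ∧ (t.map X).prod = w}) :
    φ (a * (X k ^ q * c)) = φ (X k ^ q) * φ (a * c) := by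
  replace ha := mem_span_words_of_mem_adjoin ha
  induction ha using Submodule.span_induction with
  | mem a ha =>
    obtain ⟨s, hs, rfl⟩ := ha
    induction hc using Submodule.span_induction with
    | mem c hc =>
      obtain ⟨t, ht, rfl⟩ := hc
      exact hind.map_word hφ hX s t k q (fun i hi => hs i (List.mem_of_getLast? hi)) ht
    | zero => simp
    | add x y _ _ hx hy => simp only [mul_add, map_add, hx, hy]
    | smul z x _ hx =>
      simp only [mul_smul_comm, map_smul, hx, smul_eq_mul]
      ring
  | zero => simp
  | add x y _ _ hx hy => simp only [add_mul, mul_add, map_add, hx, hy]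
  | smul z x _ hx =>
    simp only [smul_mul_assoc, map_smul, hx, smul_eq_mul]
    ring

theorem sum_range_mem_adjoin (X : ℕ → A) (N : ℕ) :
    ∑ i ∈ Finset.range N, X i ∈ Algebra.adjoin ℂ (X '' Set.Iio N) :=
  sum_mem fun i hi => Algebra.subset_adjoin ⟨i, Finset.mem_range.1 hi, rfl⟩

theorem MonotoneIndependent.map_sum_pow_mul_pow (hφ : IsState φ)
    (hX : ∀ i (c : ℂ), X i ≠ algebraMap ℂ A c) (hind : MonotoneIndependent φ X) (N j q : ℕ) :
    φ ((∑ i ∈ Finset.range N, X i) ^ j * X N ^ q) =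
      φ (X N ^ q) * φ ((∑ i ∈ Finset.range N, X i) ^ j) := by
  have h := hind.map_mul_pow_mul hφ hX N q (c := 1) (pow_mem (sum_range_mem_adjoin X N) j)
    (Submodule.subset_span ⟨[], by simp, by simp⟩)
  simpa using h

/-- The factor S_N after the run makes every word to its right begin with an index below `N`,
although S_{N+1}^r contains `X N`. This is why powers are expanded by their initial run. -/
theorem MonotoneIndependent.map_sum_pow_mul_pow_mul (hφ : IsState φ)
    (hX : ∀ i (c : ℂ), X i ≠ algebraMap ℂ A c) (hind : MonotoneIndependent φ X) (N j q r : ℕ) :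
    φ ((∑ i ∈ Finset.range N, X i) ^ j * (X N ^ q * ((∑ i ∈ Finset.range N, X i) *
        (∑ i ∈ Finset.range (N + 1), X i) ^ r))) =
      φ (X N ^ q) * φ ((∑ i ∈ Finset.range N, X i) ^ (j + 1) *
        (∑ i ∈ Finset.range (N + 1), X i) ^ r) := by
  rw [pow_succ, mul_assoc]
  refine hind.map_mul_pow_mul hφ hX N q (pow_mem (sum_range_mem_adjoin X N) j) ?_
  have hr := mem_span_words_of_mem_adjoin (pow_mem (sum_range_mem_adjoin X (N + 1)) r)
  generalize (∑ i ∈ Finset.range (N + 1), X i) ^ r = b at hr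
  rw [Finset.sum_mul]
  refine sum_mem fun i hi => ?_
  induction hr using Submodule.span_induction with
  | mem w hw =>
    obtain ⟨t, -, rfl⟩ := hw
    exact Submodule.subset_span ⟨i :: t, by simpa using Finset.mem_range.1 hi, by simp⟩
  | zero => simp
  | add x y _ _ hx hy => exact mul_add (X i) x y ▸ add_mem hx hy
  | smul z x _ hx => exact mul_smul_comm z (X i) x ▸ Submodule.smul_mem _ z hx

end Words

/-! ### The moment recurrence in the number of summands. -/

/-- Expansion of `(x + y) ^ n` by the length of the initial run of `y`. -/
theorem add_pow_eq_sum_run {R : Type*} [Semiring R] (x y : R) (n : ℕ) :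
    (x + y) ^ n = ∑ q ∈ Finset.range n, y ^ q * (x * (x + y) ^ (n - 1 - q)) + y ^ n := by
  induction n with
  | zero => simp
  | succ n ih =>
    rw [Finset.sum_range_succ', pow_succ' (x + y), add_mul]
    nth_rewrite 2 [ih]
    rw [mul_add, Finset.mul_sum, ← pow_succ', add_comm (x * _), add_right_comm]
    simp only [pow_zero, one_mul, Nat.add_sub_cancel, Nat.sub_zero]
    congr 2
    refine Finset.sum_congr rfl fun q _ => ?_
    rw [pow_succ' y q, mul_assoc, show n - 1 - q = n - (q + 1) by omega]

open Polynomial in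
/-- The polynomial `P` with `E[(x + y) ^ n] = P(x)`, where `E` is the conditional expectation onto
the algebra of `x`, and `y` is monotone independent of `x`, above it, with moments `m`. -/
noncomputable def condExpPoly (m : ℕ → ℂ) (n : ℕ) : ℂ[X] :=
  ∑ q : Fin n, C (m q) * (X * condExpPoly m (n - 1 - q)) + C (m n)
termination_by n
decreasing_by omega

open Polynomial in
theorem condExpPoly_eq (m : ℕ → ℂ) (n : ℕ) :
    condExpPoly m n =
      ∑ q ∈ Finset.range n, C (m q) * (X * condExpPoly m (n - 1 - q)) + C (m n) := by
  rw [condExpPoly, Finset.sum_range]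

/-- Removing an initial run `X N ^ q` moves the S_N that follows it to the left block and shortens
the remaining power. The induction on `n` therefore needs all `j` at once. -/
theorem MonotoneIndependent.map_sum_pow_mul_sum_succ_pow {A : Type*} [CStarAlgebra A]
    {φ : A →ₗ[ℂ] ℂ} {X : ℕ → A} (hφ : IsState φ)
    (hX : ∀ i (c : ℂ), X i ≠ algebraMap ℂ A c) (hid : IdenticallyDistributed φ X)
    (hind : MonotoneIndependent φ X) (N j n : ℕ) :
    φ ((∑ i ∈ Finset.range N, X i) ^ j * (∑ i ∈ Finset.range (N + 1), X i) ^ n) =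
      φ ((∑ i ∈ Finset.range N, X i) ^ j *
        Polynomial.aeval (∑ i ∈ Finset.range N, X i) (condExpPoly (fun q => φ (X 0 ^ q)) n)) := by
  induction n using Nat.strong_induction_on generalizing j with
  | _ n ih =>
    have hexp : (∑ i ∈ Finset.range (N + 1), X i) ^ n =
        ∑ q ∈ Finset.range n, X N ^ q * ((∑ i ∈ Finset.range N, X i) *
          (∑ i ∈ Finset.range (N + 1), X i) ^ (n - 1 - q)) + X N ^ n := by
      rw [Finset.sum_range_succ]
      exact add_pow_eq_sum_run _ _ n
    rw [hexp, condExpPoly_eq, mul_add, Finset.mul_sum, map_add, map_sum,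
      hind.map_sum_pow_mul_pow hφ hX, hid N 0, map_add, map_sum, mul_add, Finset.mul_sum, map_add,
      map_sum]
    congr 1
    · refine Finset.sum_congr rfl fun q hq => ?_
      rw [Finset.mem_range] at hq
      rw [hind.map_sum_pow_mul_pow_mul hφ hX, hid N 0, ih (n - 1 - q) (by omega) (j + 1),
        map_mul (Polynomial.aeval _), map_mul (Polynomial.aeval _), Polynomial.aeval_C, Polynomial.aeval_X, ← Algebra.smul_def, mul_smul_comm,
        map_smul, smul_eq_mul, pow_succ, mul_assoc]
    · rw [Polynomial.aeval_C, ← Algebra.commutes, ← Algebra.smul_def, map_smul, smul_eq_mul]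

open Polynomial in
theorem X_mul_mem_degreeLT {R : Type*} [CommRing R] {p : R[X]} {n : ℕ} (hp : p ∈ degreeLT R n) :
    X * p ∈ degreeLT R (n + 1) := by
  rw [mem_degreeLT, degree_lt_iff_coeff_zero] at hp ⊢
  intro k hk
  obtain ⟨k, rfl⟩ : ∃ l, k = l + 1 := ⟨k - 1, by omega⟩
  rw [coeff_X_mul]
  exact hp k (by omega)

open Polynomial in
theorem C_mul_X_pow_mem_degreeLT {R : Type*} [CommRing R] (c : R) {k n : ℕ} (h : k < n) :
    C c * X ^ k ∈ degreeLT R n := by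
  rw [mem_degreeLT]
  exact (degree_C_mul_X_pow_le k c).trans_lt (by exact_mod_cast h)

-- For n ≤ 2 the difference is exactly 0; truncated subtraction makes the coefficient n - 1 vanish
-- at n = 0 and n = 1.
open Polynomial in
theorem condExpPoly_sub_mem_degreeLT {m : ℕ → ℂ} (h0 : m 0 = 1) (h1 : m 1 = 0) (h2 : m 2 = 1)
    (n : ℕ) :
    condExpPoly m n - (X ^ n + C ((n - 1 : ℕ) : ℂ) * X ^ (n - 2)) ∈ degreeLT ℂ (n - 2) := by
  have hP0 : condExpPoly m 0 = 1 := by rw [condExpPoly_eq]; simp [h0]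
  have hP1 : condExpPoly m 1 = X := by rw [condExpPoly_eq]; simp [h0, h1, hP0]
  have hP2 : condExpPoly m 2 = X ^ 2 + 1 := by
    rw [condExpPoly_eq]
    simp [Finset.sum_range_succ, h0, h1, h2, hP1, sq]
  induction n using Nat.strong_induction_on with
  | _ n ih =>
    have hlow : ∀ k < n, condExpPoly m k - X ^ k ∈ degreeLT ℂ k := by
      intro k hk
      have hmono : degreeLT ℂ (k - 2) ≤ degreeLT ℂ k := degreeLT_mono (by omega)
      have h := hmono (ih k hk)
      have hX : C ((k - 1 : ℕ) : ℂ) * X ^ (k - 2) ∈ degreeLT ℂ k := by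
        rcases Nat.lt_or_ge 1 k with hk1 | hk1
        · exact C_mul_X_pow_mem_degreeLT _ (by omega)
        · rw [show k - 1 = 0 by omega]
          simp
      convert add_mem h hX using 1
      ring
    have hdeg : ∀ k < n, condExpPoly m k ∈ degreeLT ℂ (k + 1) := by
      intro k hk
      have hmono : degreeLT ℂ k ≤ degreeLT ℂ (k + 1) := degreeLT_mono (by omega)
      have hX := C_mul_X_pow_mem_degreeLT (1 : ℂ) (Nat.lt_succ_self k)
      convert add_mem (hmono (hlow k hk)) hX using 1
      simp
    rcases n with _ | _ | _ | n
    · simp [hP0]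
    · simp [hP1]
    · simp [hP2]
    -- The run of length 0 gives x P_{n+2}, with second coefficient n + 1; length 1 vanishes as the
    -- mean is 0; length 2 gives x P_n, adding 1 to that coefficient. Longer runs have degree at
    -- most n.
    · have hmid := ih (n + 2) (by omega)
      have hexp : condExpPoly m (n + 3) =
          ∑ q ∈ Finset.range n, C (m (q + 3)) * (X * condExpPoly m (n - 1 - q)) +
            X * condExpPoly m n + X * condExpPoly m (n + 2) + C (m (n + 3)) := by
        rw [condExpPoly_eq, Finset.sum_range_succ', Finset.sum_range_succ', Finset.sum_range_succ']
        simp only [zero_add, Nat.reduceAdd, h0, h1, h2, map_zero, zero_mul, add_zero, map_one,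
          one_mul, Nat.sub_zero]
        congr 3
        · refine Finset.sum_congr rfl fun q hq => ?_
          rw [Finset.mem_range] at hq
          rw [show n + 3 - 1 - (q + 1 + 1 + 1) = n - 1 - q by omega]
      have hsum : ∑ q ∈ Finset.range n, C (m (q + 3)) * (X * condExpPoly m (n - 1 - q)) ∈
          degreeLT ℂ (n + 1) := by
        refine sum_mem fun q hq => ?_
        rw [Finset.mem_range] at hq
        rw [← smul_eq_C_mul]
        have hmono : degreeLT ℂ (n - 1 - q + 1 + 1) ≤ degreeLT ℂ (n + 1) :=
          degreeLT_mono (by omega)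
        exact Submodule.smul_mem _ _ (hmono (X_mul_mem_degreeLT (hdeg _ (by omega))))
      have hC := C_mul_X_pow_mem_degreeLT (m (n + 3)) (Nat.succ_pos n)
      have h := add_mem (add_mem hsum hC) (add_mem (X_mul_mem_degreeLT (hlow n (by omega)))
        (X_mul_mem_degreeLT hmid))
      change condExpPoly m (n + 3) - (X ^ (n + 3) + C ((n + 2 : ℕ) : ℂ) * X ^ (n + 1)) ∈
        degreeLT ℂ (n + 1)
      convert h using 1
      rw [hexp]
      simp only [Nat.add_sub_cancel, show n + 2 - 1 = n + 1 by omega]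
      rw [show ((n + 2 : ℕ) : ℂ) = ((n + 1 : ℕ) : ℂ) + 1 by push_cast; ring, map_add, map_one]
      generalize ∑ q ∈ Finset.range n, C (m (q + 3)) * (X * condExpPoly m (n - 1 - q)) = S
      ring

/-- Recurrence in the number of summands for the moments of sums of monotone independent,
identically distributed elements; the coefficients do not depend on that number. -/
theorem MonotoneIndependent.exists_map_sum_succ_pow {A : Type*} [CStarAlgebra A]
    {φ : A →ₗ[ℂ] ℂ} {X : ℕ → A} (hφ : IsState φ)
    (hX : ∀ i (c : ℂ), X i ≠ algebraMap ℂ A c) (hid : IdenticallyDistributed φ X)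
    (hind : MonotoneIndependent φ X) (hmean : φ (X 0) = 0) (hvar : φ (X 0 ^ 2) = 1) (n : ℕ) :
    ∃ (s : Finset ℕ) (c : ℕ → ℂ), (∀ i ∈ s, i < n - 2) ∧ ∀ N,
      φ ((∑ i ∈ Finset.range (N + 1), X i) ^ n) = φ ((∑ i ∈ Finset.range N, X i) ^ n) +
        ((n - 1 : ℕ) : ℂ) * φ ((∑ i ∈ Finset.range N, X i) ^ (n - 2)) +
        ∑ k ∈ s, c k * φ ((∑ i ∈ Finset.range N, X i) ^ k) := by
  set m : ℕ → ℂ := fun q => φ (X 0 ^ q) with hm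
  have hR := condExpPoly_sub_mem_degreeLT (m := m) (by simp [hm, hφ.map_one])
    (by simpa [hm] using hmean) hvar n
  set R := condExpPoly m n -
    (Polynomial.X ^ n + Polynomial.C ((n - 1 : ℕ) : ℂ) * Polynomial.X ^ (n - 2)) with hRdef
  refine ⟨R.support, R.coeff, fun i hi => ?_, fun N => ?_⟩
  · rw [Polynomial.mem_degreeLT] at hR
    exact_mod_cast (Polynomial.le_degree_of_mem_supp i hi).trans_lt hR
  · have h := hind.map_sum_pow_mul_sum_succ_pow hφ hX hid N 0 n
    rw [pow_zero, one_mul, one_mul] at h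
    have hP : condExpPoly m n = Polynomial.X ^ n +
        Polynomial.C ((n - 1 : ℕ) : ℂ) * Polynomial.X ^ (n - 2) + R := by
      rw [hRdef]
      ring
    have hRe : Polynomial.aeval (∑ i ∈ Finset.range N, X i) R =
        ∑ k ∈ R.support, R.coeff k • (∑ i ∈ Finset.range N, X i) ^ k := by
      simp_rw [Polynomial.aeval_def, Polynomial.eval₂_eq_sum, Polynomial.sum, ← Algebra.smul_def]
    rw [h, hP, map_add, map_add, map_add, map_add, map_mul (Polynomial.aeval _),
      Polynomial.aeval_C, map_pow (Polynomial.aeval _), map_pow (Polynomial.aeval _),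
      Polynomial.aeval_X, ← Algebra.smul_def, map_smul, smul_eq_mul, hRe, map_sum]
    simp_rw [map_smul, smul_eq_mul]

/-! ### Asymptotic solution of the recurrence. -/

/-- The leading term `(n - 1)!! (N choose n / 2)` of the `n`-th moment of a sum of `N` elements. -/
noncomputable def leadingMoment (N n : ℕ) : ℂ :=
  if Even n then (Nat.doubleFactorial (n - 1) : ℂ) * (N.choose (n / 2) : ℂ) else 0

theorem leadingMoment_even (N k : ℕ) :
    leadingMoment N (2 * k) = (Nat.doubleFactorial (2 * k - 1) : ℂ) * (N.choose k : ℂ) := by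
  rw [leadingMoment, if_pos (even_two_mul k), Nat.mul_div_cancel_left k two_pos]

theorem leadingMoment_odd (N k : ℕ) : leadingMoment N (2 * k + 1) = 0 :=
  if_neg (Nat.not_even_iff_odd.2 (odd_two_mul_add_one k))

/-- Pascal's rule together with (2k+1)!! = (2k+1)(2k-1)!!: the recurrence is solved exactly once its
lower-order terms are dropped. -/
theorem leadingMoment_succ (N n : ℕ) :
    leadingMoment (N + 1) (n + 2) =
      leadingMoment N (n + 2) + ((n + 1 : ℕ) : ℂ) * leadingMoment N n := by
  obtain ⟨k, rfl | rfl⟩ := Nat.even_or_odd' n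
  · rw [show 2 * k + 2 = 2 * (k + 1) by ring, leadingMoment_even, leadingMoment_even,
      leadingMoment_even, Nat.choose_succ_succ, doubleFactorial_succ_two_mul_sub_one]
    push_cast
    ring
  · rw [show 2 * k + 1 + 2 = 2 * (k + 1) + 1 by ring]
    simp only [leadingMoment_odd, mul_zero, add_zero]

theorem leadingMoment_zero_succ (n : ℕ) : leadingMoment 0 (n + 1) = 0 := by
  obtain ⟨k, hk | hk⟩ := Nat.even_or_odd' (n + 1)
  · rw [hk, leadingMoment_even, Nat.choose_eq_zero_of_lt (by omega), Nat.cast_zero, mul_zero]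
  · rw [hk, leadingMoment_odd]

theorem norm_leadingMoment_le (N n : ℕ) :
    ‖leadingMoment N n‖ ≤ Nat.doubleFactorial (n - 1) * √((N : ℝ) + 1) ^ n := by
  obtain ⟨k, rfl | rfl⟩ := Nat.even_or_odd' n
  · rw [leadingMoment_even, norm_mul, Complex.norm_natCast, Complex.norm_natCast, pow_mul,
      Real.sq_sqrt (by positivity)]
    gcongr
    calc (N.choose k : ℝ) ≤ ((N ^ k : ℕ) : ℝ) := by exact_mod_cast Nat.choose_le_pow N k
      _ = (N : ℝ) ^ k := by push_cast; rfl
      _ ≤ ((N : ℝ) + 1) ^ k := by gcongr; linarith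
  · rw [leadingMoment_odd, norm_zero]
    positivity

/-- A telescoping sum of `N` increments, each bounded by the largest, costs one factor N + 1, that
is, two powers of its square root. -/
theorem norm_le_of_norm_succ_sub_le {E : Type*} [SeminormedAddCommGroup E] {f : ℕ → E} {L : ℝ}
    {m : ℕ} (hL : 0 ≤ L) (h0 : f 0 = 0)
    (h : ∀ N : ℕ, ‖f (N + 1) - f N‖ ≤ L * √((N : ℝ) + 1) ^ m) (N : ℕ) :
    ‖f N‖ ≤ L * √((N : ℝ) + 1) ^ (m + 2) := by
  have key : ∀ N : ℕ, ‖f N‖ ≤ L * (N * √((N : ℝ) + 1) ^ m) := by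
    intro N
    induction N with
    | zero => simp [h0]
    | succ N ih =>
      calc ‖f (N + 1)‖ ≤ ‖f N‖ + ‖f (N + 1) - f N‖ := norm_le_norm_add_norm_sub' _ _
        _ ≤ L * (N * √((N : ℝ) + 1) ^ m) + L * √((N : ℝ) + 1) ^ m := add_le_add ih (h N)
        _ = L * (((N + 1 : ℕ) : ℝ) * √((N : ℝ) + 1) ^ m) := by push_cast; ring
        _ ≤ L * (((N + 1 : ℕ) : ℝ) * √(((N + 1 : ℕ) : ℝ) + 1) ^ m) := by
          gcongr
          simp
  refine (key N).trans ?_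
  rw [pow_add, Real.sq_sqrt (by positivity), mul_comm (_ ^ m)]
  gcongr
  linarith

/-- Sequences satisfying the moment recurrence agree with `leadingMoment` up to lower order. -/
theorem exists_norm_sub_leadingMoment_le {a : ℕ → ℕ → ℂ} (ha0 : ∀ N, a N 0 = 1)
    (h0a : ∀ n, a 0 (n + 1) = 0)
    (hrec : ∀ n, ∃ (s : Finset ℕ) (c : ℕ → ℂ), (∀ i ∈ s, i < n - 2) ∧ ∀ N,
      a (N + 1) n = a N n + ((n - 1 : ℕ) : ℂ) * a N (n - 2) + ∑ k ∈ s, c k * a N k) (n : ℕ) :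
    ∃ K : ℝ, 0 ≤ K ∧ ∀ N : ℕ, ‖a N n - leadingMoment N n‖ ≤ K * √((N : ℝ) + 1) ^ (n - 1) := by
  induction n using Nat.strong_induction_on with
  | _ n ih =>
    obtain ⟨s, c, hs, hsc⟩ := hrec n
    rcases n with _ | _ | _ | n
    · exact ⟨0, le_rfl, fun N => by simp [ha0, leadingMoment]⟩
    · refine ⟨0, le_rfl, fun N => ?_⟩
      obtain rfl : s = ∅ := Finset.eq_empty_of_forall_notMem fun i hi => by simpa using hs i hi
      have h : a N 1 = 0 := by
        induction N with
        | zero => exact h0a 0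
        | succ N ihN => simpa [ihN] using hsc N
      simp [h, leadingMoment]
    · refine ⟨0, le_rfl, fun N => ?_⟩
      obtain rfl : s = ∅ := Finset.eq_empty_of_forall_notMem fun i hi => by simpa using hs i hi
      have h : a N 2 = N := by
        induction N with
        | zero => simpa using h0a 1
        | succ N ihN => simpa [ihN, ha0] using hsc N
      simp [h, leadingMoment]
    -- For the moment of order n + 3, the increment of the error involves the error at order n + 1
    -- and moments of order at most n. Both are O(√(N+1)^n), and summing over `N` gives the required
    -- exponent n + 2.
    · have hbound : ∀ i < n + 3, ∃ K : ℝ, 0 ≤ K ∧ ∀ N : ℕ, ‖a N i‖ ≤ K * √((N : ℝ) + 1) ^ i := by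
        intro i hi
        obtain ⟨K, hK, hKN⟩ := ih i hi
        refine ⟨K + Nat.doubleFactorial (i - 1), by positivity, fun N => ?_⟩
        have h1 : 1 ≤ √((N : ℝ) + 1) := by
          rw [Real.one_le_sqrt]
          linarith [Nat.cast_nonneg (α := ℝ) N]
        calc ‖a N i‖ = ‖(a N i - leadingMoment N i) + leadingMoment N i‖ := by
              rw [sub_add_cancel]
          _ ≤ ‖a N i - leadingMoment N i‖ + ‖leadingMoment N i‖ := norm_add_le _ _
          _ ≤ K * √((N : ℝ) + 1) ^ (i - 1) +
              Nat.doubleFactorial (i - 1) * √((N : ℝ) + 1) ^ i :=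
            add_le_add (hKN N) (norm_leadingMoment_le N i)
          _ ≤ K * √((N : ℝ) + 1) ^ i + Nat.doubleFactorial (i - 1) * √((N : ℝ) + 1) ^ i := by
            gcongr
            omega
          _ = _ := by ring
      choose! B hB hBN using hbound
      obtain ⟨K, hK, hKN⟩ := ih (n + 1) (by omega)
      have hL : 0 ≤ ((n + 2 : ℕ) : ℝ) * K + ∑ k ∈ s, ‖c k‖ * B k := by
        refine add_nonneg (by positivity) (Finset.sum_nonneg fun k hk => ?_)
        exact mul_nonneg (norm_nonneg _) (hB k (by have := hs k hk; omega))
      refine ⟨_, hL, norm_le_of_norm_succ_sub_le (f := fun N => a N (n + 3) -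
        leadingMoment N (n + 3)) (m := n) hL ?_ fun N => ?_⟩
      · rw [h0a, leadingMoment_zero_succ, sub_zero]
      · have h1 : 1 ≤ √((N : ℝ) + 1) := by
          rw [Real.one_le_sqrt]
          linarith [Nat.cast_nonneg (α := ℝ) N]
        have hdiff : a (N + 1) (n + 3) - leadingMoment (N + 1) (n + 3) -
            (a N (n + 3) - leadingMoment N (n + 3)) =
            ((n + 2 : ℕ) : ℂ) * (a N (n + 1) - leadingMoment N (n + 1)) +
              ∑ k ∈ s, c k * a N k := by
          rw [show n + 3 = (n + 1) + 2 by ring, leadingMoment_succ]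
          have h := hsc N
          simp only [Nat.add_sub_cancel, show n + 1 + 1 + 1 - 2 = n + 1 by omega] at h
          rw [show n + 1 + 2 = n + 1 + 1 + 1 by ring, h]
          push_cast
          ring
        rw [hdiff, add_mul, Finset.sum_mul]
        refine (norm_add_le _ _).trans (add_le_add ?_ ?_)
        · rw [norm_mul, Complex.norm_natCast, mul_assoc]
          gcongr
          exact hKN N
        · refine (norm_sum_le _ _).trans (Finset.sum_le_sum fun k hk => ?_)
          have hk' : k < n + 1 := by have := hs k hk; omega
          have hBk := hB k (by omega)
          rw [norm_mul, mul_assoc]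
          gcongr
          refine (hBN k (by omega) N).trans ?_
          gcongr
          omega

/-! ### Limits of the rescaled moments. -/

theorem tendsto_choose_div_pow (k : ℕ) :
    Tendsto (fun N : ℕ => (N.choose k : ℝ) / (N : ℝ) ^ k) atTop (𝓝 (1 / (k.factorial : ℝ))) := by
  have h := (isEquivalent_choose k).div
    (Asymptotics.IsEquivalent.refl (u := fun N : ℕ => (N : ℝ) ^ k) (l := atTop))
  refine h.symm.tendsto_nhds (tendsto_const_nhds.congr' ?_)
  filter_upwards [eventually_gt_atTop 0] with N hN
  simp only [Pi.div_apply]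
  field_simp

theorem tendsto_leadingMoment (n : ℕ) :
    Tendsto (fun N : ℕ => ((√(N : ℝ) : ℝ) : ℂ)⁻¹ ^ n * leadingMoment N n) atTop
      (𝓝 ((∫ x, x ^ n ∂arcsineMeasure : ℝ) : ℂ)) := by
  obtain ⟨k, rfl | rfl⟩ := Nat.even_or_odd' n
  · rw [integral_pow_even_arcsineMeasure]
    have h := (Complex.continuous_ofReal.tendsto _).comp
      ((tendsto_choose_div_pow k).const_mul (Nat.doubleFactorial (2 * k - 1) : ℝ))
    rw [mul_one_div] at h
    refine h.congr fun N => ?_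
    rw [leadingMoment_even, inv_pow, ← Complex.ofReal_pow, pow_mul,
      Real.sq_sqrt (Nat.cast_nonneg N)]
    simp only [Function.comp_apply]
    push_cast
    ring
  · simp only [integral_pow_odd_arcsineMeasure, leadingMoment_odd, mul_zero, Complex.ofReal_zero]
    exact tendsto_const_nhds

theorem tendsto_inv_sqrt_pow_mul {a : ℕ → ℂ} {K : ℝ} {n : ℕ}
    (h : ∀ N : ℕ, ‖a N‖ ≤ K * √((N : ℝ) + 1) ^ n) :
    Tendsto (fun N : ℕ => ((√(N : ℝ) : ℝ) : ℂ)⁻¹ ^ (n + 1) * a N) atTop (𝓝 0) := by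
  have hinv : Tendsto (fun N : ℕ => K * 2 ^ n * (√(N : ℝ))⁻¹) atTop (𝓝 0) := by
    rw [← mul_zero (K * 2 ^ n)]
    exact ((tendsto_inv_atTop_zero.comp Real.tendsto_sqrt_atTop).comp
      tendsto_natCast_atTop_atTop).const_mul _
  refine squeeze_zero_norm' ?_ hinv
  filter_upwards [eventually_gt_atTop 0] with N hN
  have hN1 : (1 : ℝ) ≤ N := by exact_mod_cast hN
  have hpos : 0 < √(N : ℝ) := by positivity
  have hK : 0 ≤ K := by
    by_contra! hK
    exact absurd ((norm_nonneg _).trans (h N)) (not_le.2 (mul_neg_of_neg_of_pos hK (by positivity)))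
  have hle : √((N : ℝ) + 1) ≤ 2 * √(N : ℝ) := by
    rw [Real.sqrt_le_left (by positivity), mul_pow, Real.sq_sqrt (by positivity)]
    linarith
  rw [norm_mul, norm_pow, norm_inv, Complex.norm_real, Real.norm_of_nonneg hpos.le]
  calc (√(N : ℝ))⁻¹ ^ (n + 1) * ‖a N‖ ≤ (√(N : ℝ))⁻¹ ^ (n + 1) * (K * (2 * √(N : ℝ)) ^ n) := by
        gcongr
        exact (h N).trans (by gcongr)
    _ = K * 2 ^ n * (√(N : ℝ))⁻¹ := by
        rw [inv_pow, mul_pow, pow_succ]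
        field_simp

theorem MonotoneIndependent.tendsto_map_normalizedSum_pow {A : Type*} [CStarAlgebra A]
    {φ : A →ₗ[ℂ] ℂ} {X : ℕ → A} (hφ : IsState φ) (hid : IdenticallyDistributed φ X)
    (hind : MonotoneIndependent φ X) (hmean : φ (X 0) = 0) (hvar : φ (X 0 ^ 2) = 1) (n : ℕ) :
    Tendsto (fun N => φ (normalizedSum X N ^ n)) atTop
      (𝓝 ((∫ x, x ^ n ∂arcsineMeasure : ℝ) : ℂ)) := by
  -- A scalar c would have mean c = 0 and second moment c² = 1.
  have hX : ∀ i (c : ℂ), X i ≠ algebraMap ℂ A c := by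
    intro i c h
    have h1 := hid i 0 1
    have h2 := hid i 0 2
    rw [hvar, h, ← map_pow, Algebra.algebraMap_eq_smul_one, map_smul, hφ.map_one] at h2
    rw [pow_one, pow_one, hmean, h, Algebra.algebraMap_eq_smul_one, map_smul, hφ.map_one] at h1
    simp only [smul_eq_mul, mul_one] at h1 h2
    simp [h1] at h2
  have hnorm : ∀ N, φ (normalizedSum X N ^ n) =
      ((√(N : ℝ) : ℝ) : ℂ)⁻¹ ^ n * φ ((∑ i ∈ Finset.range N, X i) ^ n) := by
    intro N
    rw [normalizedSum, smul_pow, map_smul, smul_eq_mul]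
  obtain ⟨K, -, hK⟩ := exists_norm_sub_leadingMoment_le
    (a := fun N n => φ ((∑ i ∈ Finset.range N, X i) ^ n)) (fun N => by simp [hφ.map_one])
    (fun n => by simp) (fun n => hind.exists_map_sum_succ_pow hφ hX hid hmean hvar n) n
  -- At n = 0 the truncated exponent n - 1 gives no gain over the normalisation, but both moments
  -- equal 1.
  rcases n with _ | n
  · have := isProbabilityMeasure_arcsineMeasure
    simp [hφ.map_one]
  · have h := (tendsto_inv_sqrt_pow_mul hK).add (tendsto_leadingMoment (n + 1))
    rw [zero_add] at h
    refine h.congr fun N => ?_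
    rw [hnorm, Nat.add_sub_cancel]
    ring

theorem isSelfAdjoint_normalizedSum {A : Type*} [CStarAlgebra A] {X : ℕ → A}
    (hsa : ∀ i, IsSelfAdjoint (X i)) (N : ℕ) : IsSelfAdjoint (normalizedSum X N) := by
  refine IsSelfAdjoint.smul ?_ (isSelfAdjoint_sum _ fun i _ => hsa i)
  rw [← Complex.ofReal_inv]
  exact Complex.conj_ofReal _

end MonotoneCLT

theorem mainTheorem4 {A : Type*} [CStarAlgebra A] (φ : A →ₗ[ℂ] ℂ) (hφ : MonotoneCLT.IsState φ)
    (X : ℕ → A) (hsa : ∀ i, IsSelfAdjoint (X i))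
    (hid : MonotoneCLT.IdenticallyDistributed φ X)
    (hind : MonotoneCLT.MonotoneIndependent φ X)
    (hmean : φ (X 0) = 0) (hvar : φ (X 0 ^ 2) = 1) :
    (∀ N : ℕ, ∃! μ : ProbabilityMeasure ℝ,
      MonotoneCLT.IsDistribution φ (MonotoneCLT.normalizedSum X N) μ) ∧
    (∀ μ : ℕ → ProbabilityMeasure ℝ,
      (∀ N, MonotoneCLT.IsDistribution φ (MonotoneCLT.normalizedSum X N) (μ N)) →
      Tendsto μ atTop (𝓝 MonotoneCLT.arcsineLaw)) ∧
    (∀ n : ℕ, Integrable (fun x : ℝ => x ^ n) (MonotoneCLT.arcsineLaw : Measure ℝ)) ∧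
    (∀ n : ℕ, ∫ x, x ^ (2 * n) ∂(MonotoneCLT.arcsineLaw : Measure ℝ) =
      (Nat.doubleFactorial (2 * n - 1) : ℝ) / (Nat.factorial n : ℝ)) ∧
    (∀ n : ℕ, ∫ x, x ^ (2 * n + 1) ∂(MonotoneCLT.arcsineLaw : Measure ℝ) = 0) := by
  refine ⟨fun N => MonotoneCLT.existsUnique_isDistribution hφ
    (MonotoneCLT.isSelfAdjoint_normalizedSum hsa N),
    fun μ hμ => ?_, ?_, MonotoneCLT.integral_pow_even_arcsineMeasure,
    MonotoneCLT.integral_pow_odd_arcsineMeasure⟩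
  · refine MonotoneCLT.tendsto_of_tendsto_moments (fun N => ?_) isCompact_Icc
      MonotoneCLT.arcsineMeasure_compl_Icc fun n => ?_
    · obtain ⟨⟨K, hK, hμK⟩, -⟩ := hμ N
      exact MonotoneCLT.integrable_pow_of_compl_null hK hμK
    · have h := hind.tendsto_map_normalizedSum_pow hφ hid hmean hvar n
      simp_rw [fun N => (hμ N).2 n] at h
      exact Complex.continuous_re.tendsto _ |>.comp h
  · exact MonotoneCLT.integrable_pow_of_compl_null isCompact_Icc
      MonotoneCLT.arcsineMeasure_compl_Icc
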